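/- There exist a family $(F_n)_{n\ge 1}$ of CNF formulas, where $F_n$ has exactly the $n$ variables $x_1,\dots,x_n$ (each of them occurs in $F_n$), a polynomial $p$ and a constant $c>0$ such that for every $n\ge 1$: (1) $F_n$ is represented by a tree decision diagram (TDD) of size at most $p(n)$; (2) every ordered binary decision diagram (OBDD) that represents $F_n$, for whichever variable order, has size (number of nodes) at least $n^{c\log_2 n}$. Here an OBDD over a variable set $X$ is a finite directed acyclic graph with a unique source. Each of its nodes of outdegree $0$ (sinks) is labeled by a constant $0$ or $1$, and every other node tests a variable of $X$ and has one outgoing edge labeled $0$ and one labeled $1$. For some linear order on $X$, the variables tested along each path are strictly increasing. An assignment $\tau$ is a model if the path from the source that follows, at each node testing $x$, the edge labeled $\tau(x)$ ends in a $1$-sink. A vtree over $X$ is a rooted binary tree $T$ whose leaves are in bijection with $X$. A TDD over $X$ consists of a vtree $T$ over $X$; a finite set $N_t$ of nodes for each node $t$ of $T$ (pairwise disjoint); if $t$ is a leaf with variable $x$, a label in $\{x,\neg x,0,1\}$ for each $g\in N_t$; if $t$ has children $t_1,t_2$, an input set $E(g)\subseteq N_{t_1}\times N_{t_2}$ for each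 $g\in N_t$; and an output node in $N_r$, where $r$ is the root of $T$. It is required that no two distinct nodes of $N_t$ with $t$ a leaf can be satisfied simultaneously, and that $E(g)\cap E(g')=\emptyset$ for distinct $g,g'\in N_t$ with $t$ internal. A node of a leaf is satisfied by $\tau$ according to its label; a node $g$ of an internal node is satisfied by $\tau$ if some $(g_1,g_2)\in E(g)$ has both $g_1$ and $g_2$ satisfied by $\tau$. The models of the TDD are the assignments that satisfy its output node, and its size is $\sum_g |E(g)|$. A diagram represents $F_n$ if it is a diagram over the variables of $F_n$ whose models are exactly the satisfying assignments of $F_n$. -/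

import Mathlib

namespace KComp

/-- A literal over `X`: `(x, true)` is the literal `x`, and `(x, false)` is `¬x`. -/
abbrev Literal (X : Type) := X × Bool

/-- A clause is a finite set of literals, read as their disjunction. -/
abbrev Clause (X : Type) := Finset (Literal X)

/-- A CNF formula is a finite set of clauses, read as their conjunction. -/
abbrev CNF (X : Type) := Finset (Clause X)

/-- The assignment `τ` satisfies the clause `c`. -/
def Clause.Sat {X : Type} (c : Clause X) (τ : X → Bool) : Prop :=
  ∃ l ∈ c, τ l.1 = l.2

/-- The set of variables that occur in the clause `c`. -/
def Clause.vars {X : Type} (c : Clause X) : Set X :=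
  {x | ∃ l ∈ c, l.1 = x}

/-- The assignment `τ` satisfies the CNF formula `F`. -/
def CNF.Sat {X : Type} (F : CNF X) (τ : X → Bool) : Prop :=
  ∀ c ∈ F, Clause.Sat c τ

/-- The set of variables that occur in the CNF formula `F`. -/
def CNF.vars {X : Type} (F : CNF X) : Set X :=
  {x | ∃ c ∈ F, x ∈ Clause.vars c}

/-! ### Ordered binary decision diagrams -/

/-- What a node of a decision diagram with node set `N` carries: a sink carries a constant; a
decision node carries the tested variable `x`, the end `lo` of its edge labeled `0` and the end `hi`
of its edge labeled `1`. -/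
inductive NodeData (X N : Type) : Type
  | sink (b : Bool) : NodeData X N
  | decision (x : X) (lo hi : N) : NodeData X N

/-- There is an edge (with either label) from `u` to `v`. -/
def NodeData.Edge {X N : Type} (data : N → NodeData X N) (u v : N) : Prop :=
  ∃ x lo hi, data u = NodeData.decision x lo hi ∧ (v = lo ∨ v = hi)

/-- Ordered binary decision diagrams over the variables `X`. -/
structure OBDD (X : Type) where
  /-- the nodes, sinks included -/
  Node : Type
  finite_node : Finite Node
  data : Node → NodeData X Node
  acyclic : ∀ v, ¬ Relation.TransGen (NodeData.Edge data) v v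
  source : Node
  /-- the source is the unique node of indegree `0` -/
  source_unique : ∀ v, (∀ u, ¬ NodeData.Edge data u v) ↔ v = source
  /-- along every path, the variables tested are strictly increasing for some order on `X` -/
  ordered : ∃ ord : LinearOrder X, ∀ (u v : Node) (x y : X) (lo hi lo' hi' : Node),
    data u = NodeData.decision x lo hi → data v = NodeData.decision y lo' hi' →
    Relation.TransGen (NodeData.Edge data) u v → ord.lt x y

/-- There is an edge from `u` to `v` whose label is `τ x`, where `x` is the variable `u` tests. -/
def OBDD.Step {X : Type} (D : OBDD X) (τ : X → Bool) (u v : D.Node) : Prop :=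
  ∃ x lo hi, D.data u = NodeData.decision x lo hi ∧ v = if τ x = true then hi else lo

/-- The assignment `τ` satisfies `D`: a path compatible with `τ` leads from the source to a
`1`-sink. -/
def OBDD.Sat {X : Type} (D : OBDD X) (τ : X → Bool) : Prop :=
  ∃ v, Relation.ReflTransGen (D.Step τ) D.source v ∧ D.data v = NodeData.sink true

/-- The size of an OBDD is its number of nodes. -/
noncomputable def OBDD.size {X : Type} (D : OBDD X) : ℕ := Nat.card D.Node

/-- The OBDD `D` represents the CNF formula `F`. -/
def OBDD.Represents {X : Type} (D : OBDD X) (F : CNF X) : Prop :=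
  ∀ τ : X → Bool, D.Sat τ ↔ CNF.Sat F τ

/-! ### Tree decision diagrams -/

/-- Rooted binary trees with leaves labeled in `X`. -/
inductive BinTree (X : Type) : Type
  | leaf (x : X) : BinTree X
  | node (l r : BinTree X) : BinTree X

/-- The labels of the leaves, from left to right. -/
def BinTree.leaves {X : Type} : BinTree X → List X
  | .leaf x => [x]
  | .node l r => l.leaves ++ r.leaves

/-- `T` is a vtree over `X`: its leaves are in one-to-one correspondence with `X`. -/
def BinTree.IsVTree {X : Type} (T : BinTree X) : Prop :=
  T.leaves.Nodup ∧ ∀ x : X, x ∈ T.leaves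

/-- The possible labels `x`, `¬x`, `1`, `0` of a node that belongs to a leaf labeled by `x`. -/
inductive LeafLabel : Type
  | pos
  | neg
  | one
  | zero

/-- The value `b` of the variable of the leaf satisfies the label. -/
def LeafLabel.Sat : LeafLabel → Bool → Prop
  | .pos, b => b = true
  | .neg, b => b = false
  | .one, _ => True
  | .zero, _ => False

/-- `Diagram T k` is the collection of all `t`-nodes, for `t` ranging over the nodes of `T`, with
their labels and inputs, where the number of nodes that belong to the root of `T` is `k`. The
`t`-nodes of each `t` are numbered, so that the nodes that belong to the root of `T` form `Fin k`. -/
inductive Diagram {X : Type} : BinTree X → ℕ → Type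
  | leaf (x : X) {k : ℕ} (label : Fin k → LeafLabel) : Diagram (BinTree.leaf x) k
  | node {l r : BinTree X} {k₁ k₂ k : ℕ} (C₁ : Diagram l k₁) (C₂ : Diagram r k₂)
      (E : Fin k → Finset (Fin k₁ × Fin k₂)) : Diagram (BinTree.node l r) k

/-- `C.Sat g τ`: the restriction of `τ` to the variables of `T` is a model of the node `g`, which
belongs to the root of `T`. -/
def Diagram.Sat {X : Type} : {T : BinTree X} → {k : ℕ} → Diagram T k → Fin k → (X → Bool) → Prop
  | _, _, .leaf x label, g, τ => (label g).Sat (τ x)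
  | _, _, .node C₁ C₂ E, g, τ => ∃ p ∈ E g, C₁.Sat p.1 τ ∧ C₂.Sat p.2 τ

/-- The total number of inputs, that is, the sum of `|E(g)|` over all nodes `g`. -/
def Diagram.size {X : Type} : {T : BinTree X} → {k : ℕ} → Diagram T k → ℕ
  | _, _, .leaf _ _ => 0
  | _, _, .node C₁ C₂ E => C₁.size + C₂.size + ∑ g, (E g).card

/-- Determinism: no two distinct nodes of the same leaf can be satisfied simultaneously, and no
pair is an input of two distinct nodes. -/
def Diagram.Deterministic {X : Type} : {T : BinTree X} → {k : ℕ} → Diagram T k → Prop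
  | _, _, .leaf _ label => ∀ g g', g ≠ g' → ∀ b, ¬ ((label g).Sat b ∧ (label g').Sat b)
  | _, _, .node C₁ C₂ E =>
      C₁.Deterministic ∧ C₂.Deterministic ∧ ∀ g g', g ≠ g' → Disjoint (E g) (E g')

/-- Tree decision diagrams over the variables `X`. -/
structure TDD (X : Type) where
  vtree : BinTree X
  isVTree : vtree.IsVTree
  /-- the number of nodes that belong to the root of the vtree -/
  numRoot : ℕ
  diagram : Diagram vtree numRoot
  deterministic : diagram.Deterministic
  /-- the output node -/
  out : Fin numRoot

/-- The size of a TDD is the sum of `|E(g)|` over all its nodes `g`. -/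
def TDD.size {X : Type} (C : TDD X) : ℕ := C.diagram.size

/-- The TDD `C` represents the CNF formula `F`. -/
def TDD.Represents {X : Type} (C : TDD X) (F : CNF X) : Prop :=
  ∀ τ : X → Bool, C.diagram.Sat C.out τ ↔ CNF.Sat F τ

end KComp

open KComp

/-!
The formulas come from a function with a small bottom-up evaluation along a tree. A block of
`2 * q + 1` variables has as its value the number of its ones. Three copies of a structure of depth
`h` and two selector bits form a structure of depth `h + 1`: the selectors choose one of the copies,
and the value is the value of that copy if the other two have equal values, and `1` otherwise
(`nestedVal`). The formula asks for the value `0`; variables outside the structure are forced to be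
true. It is written as a CNF formula with one full clause for each violating assignment, which is
possible because only the number of variables matters, not the number of clauses.

*Upper bound.* All values are at most `2 * q + 1`, so evaluating the structure bottom-up takes only
`O((q + 1) ^ 3)` states at each node of a vtree that follows the structure (`computes_nestedTree`), and
a deterministic bottom-up evaluation is a TDD (`Computes.node`).

*Lower bound.* Fix an order of the variables. An OBDD has to lead partial assignments to an initial
segment of the variables to different nodes if they have different subfunctions
(`OBDD.exists_rank_card_le_size`). By induction on `h`, some initial segment has at least
`(q + 1) ^ h` satisfiable and pairwise different subfunctions (`exists_cut`). A block is cut in the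
middle, so that both its early and its late variables can produce all values up to `q`. For depth
`h + 1`, take the cut that is the second one among those of the three copies, and select the copy
it belongs to. One of the other copies has already passed its cut, so its early variables can still
produce all values up to `q`, and the other one has not, so its late variables can. Since these two
values are compared, the OBDD has to remember the first one, which yields another factor `q + 1`.

With `q + 1 = 2 ^ k`, depth `k` and `k` about `(log₂ n) / 4`, the structure has at most `n`
variables, the TDD has size at most `32 * n ^ 2`, and every OBDD has size at least `2 ^ (k * k)`.
-/

namespace KComp

/-! ### Canonical CNF formulas -/

open Classical in
/-- The CNF formula with one clause for each assignment that violates `P`; that clause contains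
every variable and is falsified by this assignment only. -/
noncomputable def fullCNF {X : Type} [Fintype X] (P : (X → Bool) → Prop) : CNF X :=
  (Finset.univ.filter fun σ : X → Bool => ¬ P σ).image fun σ => Finset.univ.image fun x => (x, !σ x)

theorem fullCNF_sat {X : Type} [Fintype X] (P : (X → Bool) → Prop) (τ : X → Bool) :
    (fullCNF P).Sat τ ↔ P τ := by
  classical
  constructor
  · intro h
    by_contra hP
    obtain ⟨l, hl, hx⟩ := h _ (Finset.mem_image_of_mem _ (by simpa using hP))
    obtain ⟨x, -, rfl⟩ := Finset.mem_image.1 hl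
    simp at hx
  · intro hP c hc
    obtain ⟨σ, hσ, rfl⟩ := Finset.mem_image.1 hc
    obtain ⟨x, hx⟩ : ∃ x, τ x ≠ σ x := by
      by_contra! hcon
      exact (Finset.mem_filter.1 hσ).2 (funext hcon ▸ hP)
    exact ⟨(x, !σ x), Finset.mem_image_of_mem _ (Finset.mem_univ x), Bool.eq_not.2 hx⟩

theorem fullCNF_vars {X : Type} [Fintype X] {P : (X → Bool) → Prop} (hP : ∃ σ, ¬ P σ) :
    (fullCNF P).vars = Set.univ := by
  classical
  obtain ⟨σ, hσ⟩ := hP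
  refine Set.eq_univ_of_forall fun x => ?_
  refine ⟨Finset.univ.image fun x => (x, !σ x), ?_, (x, !σ x), ?_, rfl⟩
  · exact Finset.mem_image_of_mem _ (by simpa using hσ)
  · exact Finset.mem_image_of_mem _ (Finset.mem_univ x)

/-! ### Distinguishable prefixes bound the size of an OBDD -/

/-- The assignment that takes its values from `x` on the variables of rank below `t` and from `y` on
the others. -/
def mix {V : Type} (r : V → ℕ) (t : ℕ) (x y : V → Bool) : V → Bool :=
  fun v => if r v < t then x v else y v

@[simp] theorem mix_self {V : Type} (r : V → ℕ) (t : ℕ) (x : V → Bool) : mix r t x x = x := by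
  funext v; simp [mix]

namespace OBDD

variable {X : Type} (D : OBDD X)

/-- The path compatible with `τ` that starts in the node `u` ends in a `1`-sink. -/
def SatFrom (u : D.Node) (τ : X → Bool) : Prop :=
  ∃ v, Relation.ReflTransGen (D.Step τ) u v ∧ D.data v = NodeData.sink true

variable {D}

theorem satFrom_sink {u : D.Node} {b : Bool} (h : D.data u = NodeData.sink b) (τ : X → Bool) :
    D.SatFrom u τ ↔ b = true := by
  constructor
  · rintro ⟨v, huv, hv⟩
    rcases huv.cases_head with rfl | ⟨w, ⟨x, lo, hi, hd, -⟩, -⟩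
    · rw [h] at hv
      cases hv
      rfl
    · rw [h] at hd
      cases hd
  · rintro rfl
    exact ⟨u, .refl, h⟩

theorem satFrom_decision {u lo hi : D.Node} {x : X} (h : D.data u = NodeData.decision x lo hi)
    (τ : X → Bool) : D.SatFrom u τ ↔ D.SatFrom (if τ x = true then hi else lo) τ := by
  constructor
  · rintro ⟨v, huv, hv⟩
    rcases huv.cases_head with rfl | ⟨w, ⟨x', lo', hi', hd, rfl⟩, hwv⟩
    · rw [h] at hv
      cases hv
    · rw [h] at hd
      cases hd
      exact ⟨v, hwv, hv⟩
  · rintro ⟨v, huv, hv⟩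
    exact ⟨v, .head ⟨x, lo, hi, h, rfl⟩ huv, hv⟩

theorem edge_next {u lo hi : D.Node} {x : X} (h : D.data u = NodeData.decision x lo hi) (b : Bool) :
    NodeData.Edge D.data u (if b = true then hi else lo) :=
  ⟨x, lo, hi, h, by cases b <;> simp⟩

variable (D) in
theorem wellFounded_edge : WellFounded fun v u => NodeData.Edge D.data u v := by
  have := D.finite_node
  let R : D.Node → D.Node → Prop := fun v u => Relation.TransGen (NodeData.Edge D.data) u v
  have : IsTrans D.Node R := ⟨fun _ _ _ h₁ h₂ => h₂.trans h₁⟩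
  have : Std.Irrefl R := ⟨D.acyclic⟩
  exact Subrelation.wf (r := R) (fun h => .single h) (Finite.wellFounded_of_trans_of_irrefl R)

/-- All variables tested in `u` or below `u` have rank at least `t`. -/
def TestsFrom (r : X → ℕ) (t : ℕ) (u : D.Node) : Prop :=
  ∀ w x lo hi, Relation.ReflTransGen (NodeData.Edge D.data) u w →
    D.data w = NodeData.decision x lo hi → t ≤ r x

theorem satFrom_congr {r : X → ℕ} {t : ℕ} {τ τ' : X → Bool} (hτ : ∀ x, t ≤ r x → τ x = τ' x)
    (u : D.Node) (hu : TestsFrom r t u) : D.SatFrom u τ ↔ D.SatFrom u τ' := by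
  induction u using D.wellFounded_edge.induction with
  | _ u ih =>
    cases hd : D.data u with
    | sink b => rw [satFrom_sink hd, satFrom_sink hd]
    | decision x lo hi =>
      have he := edge_next hd (τ' x)
      rw [satFrom_decision hd, satFrom_decision hd, hτ x (hu u x lo hi .refl hd)]
      exact ih _ he fun w y lo' hi' hw => hu w y lo' hi' (.head he hw)

/-- Following `σ` as long as variables of rank below `t` are tested leads to a node that decides
every assignment that agrees with `σ` on these variables. -/
theorem exists_testsFrom {r : X → ℕ}
    (hr : ∀ (u v : D.Node) (x y : X) (lo hi lo' hi' : D.Node),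
      D.data u = NodeData.decision x lo hi → D.data v = NodeData.decision y lo' hi' →
      Relation.TransGen (NodeData.Edge D.data) u v → r x < r y)
    (t : ℕ) (σ : X → Bool) (u : D.Node) :
    ∃ w, TestsFrom r t w ∧
      ∀ τ : X → Bool, (∀ x, r x < t → τ x = σ x) → (D.SatFrom u τ ↔ D.SatFrom w τ) := by
  induction u using D.wellFounded_edge.induction with
  | _ u ih =>
    cases hd : D.data u with
    | sink b =>
      refine ⟨u, fun w x lo hi hw hdw => ?_, fun _ _ => Iff.rfl⟩
      rcases hw.cases_head with rfl | ⟨_, ⟨_, _, _, hd', -⟩, -⟩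
      · rw [hd] at hdw
        cases hdw
      · rw [hd] at hd'
        cases hd'
    | decision x lo hi =>
      by_cases hx : r x < t
      · obtain ⟨w, hw, hsat⟩ := ih _ (edge_next hd (σ x))
        refine ⟨w, hw, fun τ hτ => ?_⟩
        rw [satFrom_decision hd, hτ x hx, hsat τ hτ]
      · refine ⟨u, fun w y lo' hi' hw hdw => ?_, fun _ _ => Iff.rfl⟩
        rcases Relation.reflTransGen_iff_eq_or_transGen.1 hw with rfl | hw
        · rw [hd] at hdw
          cases hdw
          omega
        · have := hr _ _ _ _ _ _ _ _ hd hdw hw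
          omega

/-- If `r` ranks the variables in the order of the OBDD `D`, then partial assignments to the
variables of rank below `t` with pairwise distinct subfunctions lead to pairwise distinct nodes. -/
theorem exists_rank_card_le_size [Fintype X] {F : CNF X} (hD : D.Represents F) :
    ∃ r : X → ℕ, Function.Injective r ∧ ∀ (t : ℕ) (I : Type) [Fintype I] (p : I → X → Bool),
      (∀ i j, i ≠ j → ∃ y, ¬ (F.Sat (mix r t (p i) y) ↔ F.Sat (mix r t (p j) y))) →
      Fintype.card I ≤ D.size := by
  classical
  obtain ⟨ord, hord⟩ := D.ordered
  let r : X → ℕ := fun x => (Finset.univ.filter fun y => ord.lt y x).card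
  have hlt : ∀ x y, ord.lt x y → r x < r y := fun x y hxy => by
    refine Finset.card_lt_card ⟨fun z hz => ?_, fun hsub => ?_⟩
    · simp only [Finset.mem_filter, Finset.mem_univ, true_and] at hz ⊢
      exact @lt_trans X ord.toPreorder _ _ _ hz hxy
    · have : x ∈ Finset.univ.filter fun z => ord.lt z x := hsub (by simpa using hxy)
      simp only [Finset.mem_filter, Finset.mem_univ, true_and] at this
      exact @lt_irrefl X ord.toPreorder x this
  have hinj : Function.Injective r := fun x y hxy => by
    rcases @lt_trichotomy X ord x y with h | h | h
    · exact absurd hxy (hlt x y h).ne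
    · exact h
    · exact absurd hxy (hlt y x h).ne'
  refine ⟨r, hinj, fun t I _ p hp => ?_⟩
  have := D.finite_node
  choose node hnode hsat using fun i => exists_testsFrom (D := D) (r := r)
    (fun u v x y lo hi lo' hi' hu hv huv => hlt _ _ (hord u v x y lo hi lo' hi' hu hv huv))
    t (p i) D.source
  have hmix : ∀ i y, F.Sat (mix r t (p i) y) ↔ D.SatFrom (node i) (mix r t (p i) y) := fun i y => by
    rw [← hsat i _ fun x hx => by simp [mix, hx]]
    exact (hD _).symm
  rw [← Nat.card_eq_fintype_card]
  refine Nat.card_le_card_of_injective node fun i j hij => ?_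
  by_contra hne
  obtain ⟨y, hy⟩ := hp i j hne
  rw [hmix, hmix, hij] at hy
  exact hy (satFrom_congr (fun x hx => by simp [mix, hx.not_gt]) _ (hnode j))

end OBDD

/-! ### The nested comparison function -/

/-- The variables of `nestedVal q h`: at depth `0`, a block of `2 * q + 1` variables; at depth
`h + 1`, two selector variables and three copies of the variables of depth `h`. -/
def Var (q : ℕ) : ℕ → Type
  | 0 => Fin (2 * q + 1)
  | h + 1 => Bool ⊕ Fin 3 × Var q h

/-- The two selector variables. -/
def Var.sel {q h : ℕ} (b : Bool) : Var q (h + 1) := Sum.inl b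

/-- The variable `v` of the `i`-th copy. -/
def Var.sub {q h : ℕ} (i : Fin 3) (v : Var q h) : Var q (h + 1) := Sum.inr (i, v)

theorem Var.sel_injective {q h : ℕ} : Function.Injective (Var.sel (q := q) (h := h)) :=
  Sum.inl_injective

theorem Var.sub_injective {q h : ℕ} (i : Fin 3) :
    Function.Injective (Var.sub (q := q) (h := h) i) :=
  Sum.inr_injective.comp (Prod.mk_right_injective i)

/-- The variable `i` of a block. -/
def Var.block {q : ℕ} (i : Fin (2 * q + 1)) : Var q 0 := i

instance Var.instFintype (q : ℕ) : ∀ h, Fintype (Var q h)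
  | 0 => inferInstanceAs (Fintype (Fin (2 * q + 1)))
  | h + 1 =>
    have := Var.instFintype q h
    inferInstanceAs (Fintype (Bool ⊕ Fin 3 × Var q h))

theorem Var.card_add_one (q h : ℕ) : Fintype.card (Var q h) + 1 = 3 ^ h * (2 * q + 2) := by
  induction h with
  | zero =>
    have : Fintype.card (Var q 0) = 2 * q + 1 := Fintype.card_fin _
    omega
  | succ h ih =>
    have : Fintype.card (Var q (h + 1)) = Fintype.card (Bool ⊕ Fin 3 × Var q h) := rfl
    rw [this, pow_succ, Fintype.card_sum, Fintype.card_prod, Fintype.card_bool, Fintype.card_fin]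
    linarith

/-- `c` if `a = b`, and the default `1` otherwise. -/
def guarded (a b c : ℕ) : ℕ := if a = b then c else 1

/-- The selector bits `s` and `t` choose which of the three numbers is guarded by the comparison of
the other two. -/
def combine (s t : Bool) (v : Fin 3 → ℕ) : ℕ :=
  if s = true then guarded (v 1) (v 2) (v 0)
  else if t = true then guarded (v 0) (v 2) (v 1)
  else guarded (v 0) (v 1) (v 2)

/-- At depth `0`, the number of ones in the block; at depth `h + 1`, the values of the three copies
are combined as the selector variables say. -/
def nestedVal (q : ℕ) : (h : ℕ) → (Var q h → Bool) → ℕ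
  | 0, x => ∑ i : Fin (2 * q + 1), (x (.block i)).toNat
  | h + 1, x => combine (x (.sel false)) (x (.sel true)) fun i => nestedVal q h fun v => x (.sub i v)

theorem combine_le {s t : Bool} {v : Fin 3 → ℕ} {m : ℕ} (hm : 1 ≤ m) (hv : ∀ i, v i ≤ m) :
    combine s t v ≤ m := by
  have h0 := hv 0
  have h1 := hv 1
  have h2 := hv 2
  unfold combine guarded
  split_ifs <;> assumption

/-- Any one of three numbers can be selected as the guarded one. -/
theorem exists_combine_eq {i j l : Fin 3} (hij : i ≠ j) (hjl : j ≠ l) (hil : i ≠ l) :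
    ∃ s t, ∀ v, combine s t v = guarded (v i) (v l) (v j) := by
  have hsymm : ∀ a b c, guarded a b c = guarded b a c := fun a b c => by simp [guarded, eq_comm]
  fin_cases i <;> fin_cases j <;> fin_cases l <;>
    first
    | exact absurd rfl hij
    | exact absurd rfl hjl
    | exact absurd rfl hil
    | exact ⟨true, true, fun v => rfl⟩
    | exact ⟨true, true, fun v => hsymm _ _ _⟩
    | exact ⟨false, true, fun v => rfl⟩
    | exact ⟨false, true, fun v => hsymm _ _ _⟩
    | exact ⟨false, false, fun v => rfl⟩
    | exact ⟨false, false, fun v => hsymm _ _ _⟩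

theorem exists_sorted (t : Fin 3 → ℕ) :
    ∃ i j l : Fin 3, i ≠ j ∧ j ≠ l ∧ i ≠ l ∧ t i ≤ t j ∧ t j ≤ t l := by
  have hs := Tuple.monotone_sort t
  refine ⟨Tuple.sort t 0, Tuple.sort t 1, Tuple.sort t 2, ?_, ?_, ?_, hs (by decide), hs (by decide)⟩
    <;> exact (Tuple.sort t).injective.ne (by decide)

/-! ### Many distinguishable prefixes for every variable order -/

/-- The assignment with selector bits `s` and `t` and with `x i` on the `i`-th copy. -/
def assemble {q h : ℕ} (s t : Bool) (x : Fin 3 → Var q h → Bool) : Var q (h + 1) → Bool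
  | .inl b => if b = true then t else s
  | .inr (i, v) => x i v

theorem nestedVal_assemble {q h : ℕ} (s t : Bool) (x : Fin 3 → Var q h → Bool) :
    nestedVal q (h + 1) (assemble s t x) = combine s t fun i => nestedVal q h (x i) := rfl

theorem mix_assemble {q h : ℕ} (r : Var q (h + 1) → ℕ) (T : ℕ) (s t : Bool)
    (x y : Fin 3 → Var q h → Bool) :
    mix r T (assemble s t x) (assemble s t y) =
      assemble s t fun i => mix (fun v => r (.sub i v)) T (x i) (y i) := by
  funext v
  match v with
  | .inl b => exact ite_self _
  | .inr (i, v) => rfl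

/-- For some values of the late variables, the early ones can produce every value up to `q`. -/
def EarlyRange (q h : ℕ) (r : Var q h → ℕ) (t : ℕ) : Prop :=
  ∃ y, ∀ a ≤ q, ∃ x, nestedVal q h (mix r t x y) = a

/-- For some values of the early variables, the late ones can produce every value up to `q`. -/
def LateRange (q h : ℕ) (r : Var q h → ℕ) (t : ℕ) : Prop :=
  ∃ x, ∀ a ≤ q, ∃ y, nestedVal q h (mix r t x y) = a

/-- There are `(q + 1) ^ h` assignments to the early variables whose sets of completions to a zero
of `nestedVal q h` are nonempty and pairwise distinct. -/
def ManyPrefixes (q h : ℕ) (r : Var q h → ℕ) (t : ℕ) : Prop :=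
  ∃ p : (Fin h → Fin (q + 1)) → Var q h → Bool,
    (∀ i, ∃ y, nestedVal q h (mix r t (p i) y) = 0) ∧
    ∀ i j, i ≠ j →
      ∃ y, ¬ (nestedVal q h (mix r t (p i) y) = 0 ↔ nestedVal q h (mix r t (p j) y) = 0)

theorem EarlyRange.mono {q h : ℕ} {r : Var q h → ℕ} {t t' : ℕ} (ht : t ≤ t')
    (H : EarlyRange q h r t) : EarlyRange q h r t' := by
  obtain ⟨y, hy⟩ := H
  refine ⟨y, fun a ha => ?_⟩
  obtain ⟨x, hx⟩ := hy a ha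
  refine ⟨mix r t x y, ?_⟩
  rw [← hx]
  congr 1
  funext v
  by_cases h1 : r v < t'
  · simp [mix, h1]
  · simp [mix, h1, show ¬ r v < t by omega]

theorem LateRange.anti {q h : ℕ} {r : Var q h → ℕ} {t t' : ℕ} (ht : t' ≤ t)
    (H : LateRange q h r t) : LateRange q h r t' := by
  obtain ⟨x, hx⟩ := H
  refine ⟨x, fun a ha => ?_⟩
  obtain ⟨y, hy⟩ := hx a ha
  refine ⟨mix r t x y, ?_⟩
  rw [← hy]
  congr 1
  funext v
  by_cases h1 : r v < t'
  · simp [mix, h1, show r v < t by omega]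
  · simp [mix, h1]

/-- Some initial segment of a ranking splits a block into two parts with at least `q` elements. -/
theorem exists_balanced_cut {q : ℕ} {r : Fin (2 * q + 1) → ℕ} (hr : Function.Injective r) :
    ∃ t, q ≤ (Finset.univ.filter fun v => r v < t).card ∧
      q ≤ (Finset.univ.filter fun v => ¬ r v < t).card := by
  have hex : ∃ t, q ≤ (Finset.univ.filter fun v => r v < t).card := by
    refine ⟨Finset.univ.sup r + 1, ?_⟩
    rw [Finset.filter_true_of_mem fun v _ => Nat.lt_succ_of_le (Finset.le_sup (Finset.mem_univ v)),
      Finset.card_univ, Fintype.card_fin]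
    omega
  classical
  refine ⟨Nat.find hex, Nat.find_spec hex, ?_⟩
  have hsum := Finset.card_filter_add_card_filter_not (s := Finset.univ)
    (fun v => r v < Nat.find hex)
  rw [Finset.card_univ, Fintype.card_fin] at hsum
  suffices (Finset.univ.filter fun v => r v < Nat.find hex).card ≤ q + 1 by omega
  rcases hT : Nat.find hex with _ | t
  · simp
  · have hmin := Nat.find_min hex (m := t) (by omega)
    have hsub : (Finset.univ.filter fun v => r v < t + 1) ⊆
        (Finset.univ.filter fun v => r v < t) ∪ (Finset.univ.filter fun v => r v = t) := by
      intro v hv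
      simp only [Finset.mem_filter, Finset.mem_univ, true_and, Finset.mem_union] at hv ⊢
      omega
    have hone : (Finset.univ.filter fun v => r v = t).card ≤ 1 :=
      Finset.card_le_one.2 fun a ha b hb => hr <| by
        rw [(Finset.mem_filter.1 ha).2, (Finset.mem_filter.1 hb).2]
    have := Finset.card_le_card hsub
    have := Finset.card_union_le (Finset.univ.filter fun v => r v < t)
      (Finset.univ.filter fun v => r v = t)
    omega

theorem sum_toNat_decide_mem {m : ℕ} (s : Finset (Fin m)) :
    ∑ i : Fin m, (decide (i ∈ s)).toNat = s.card := by
  simp [Bool.toNat, Bool.cond_decide]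

theorem exists_cut_zero {q : ℕ} {r : Var q 0 → ℕ} (hr : Function.Injective r) :
    ∃ t, EarlyRange q 0 r t ∧ LateRange q 0 r t ∧ ManyPrefixes q 0 r t := by
  obtain ⟨t, h1, h2⟩ := exists_balanced_cut (q := q) (r := fun i => r (.block i)) hr
  refine ⟨t, ⟨fun _ => false, fun a ha => ?_⟩, ⟨fun _ => false, fun a ha => ?_⟩,
    fun _ _ => false, fun _ => ⟨fun _ => false, ?_⟩, fun i j hij => absurd (Subsingleton.elim i j) hij⟩
  · obtain ⟨s, hs, rfl⟩ := Finset.exists_subset_card_eq (ha.trans h1)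
    refine ⟨fun v => decide ((show Fin (2 * q + 1) from v) ∈ s), ?_⟩
    refine (Finset.sum_congr rfl fun v _ => ?_).trans (sum_toNat_decide_mem s)
    change (if r (.block v) < t then decide (v ∈ s) else false).toNat = _
    split_ifs with hv
    · rfl
    · rw [decide_eq_false fun h => hv (Finset.mem_filter.1 (hs h)).2]
  · obtain ⟨s, hs, rfl⟩ := Finset.exists_subset_card_eq (ha.trans h2)
    refine ⟨fun v => decide ((show Fin (2 * q + 1) from v) ∈ s), ?_⟩
    refine (Finset.sum_congr rfl fun v _ => ?_).trans (sum_toNat_decide_mem s)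
    change (if r (.block v) < t then false else decide (v ∈ s)).toNat = _
    split_ifs with hv
    · rw [decide_eq_false fun h => (Finset.mem_filter.1 (hs h)).2 hv]
    · rfl
  · rw [mix_self]
    exact Finset.sum_eq_zero fun _ _ => rfl

/-- Every ranking of the variables has a cut through which `nestedVal q h = 0` has `(q + 1) ^ h`
distinct subfunctions. In the induction step, each copy has such a cut. At the cut of the copy `j`
whose cut comes second, an earlier copy `i` can still produce all values up to `q` from its early
variables, and a later copy `l` from its late variables. With the selectors set so that `j` is
guarded by the comparison of `i` and `l`, the prefix has to remember the value of copy `i` on top of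
what it has to remember about copy `j`. -/
theorem exists_cut {q h : ℕ} {r : Var q h → ℕ} (hr : Function.Injective r) :
    ∃ t, EarlyRange q h r t ∧ LateRange q h r t ∧ ManyPrefixes q h r t := by
  induction h with
  | zero => exact exists_cut_zero hr
  | succ h ih =>
    choose T hE hL hM using fun i => ih (r := fun v => r (.sub i v))
      (hr.comp (Var.sub_injective i))
    obtain ⟨i, j, l, hij, hjl, hil, h1, h2⟩ := exists_sorted T
    obtain ⟨s, t, hst⟩ := exists_combine_eq hij hjl hil
    -- The assignment that agrees with `a`, `b`, `c` on the copies `i`, `j`, `l`.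
    let asm : (a b c : Var q h → Bool) → Var q (h + 1) → Bool := fun a b c =>
      assemble s t fun k => if k = i then a else if k = j then b else c
    have hval : ∀ a b c a' b' c', nestedVal q (h + 1) (mix r (T j) (asm a b c) (asm a' b' c')) =
        guarded (nestedVal q h (mix (fun v => r (.sub i v)) (T j) a a'))
          (nestedVal q h (mix (fun v => r (.sub l v)) (T j) c c'))
          (nestedVal q h (mix (fun v => r (.sub j v)) (T j) b b')) := by
      intro a b c a' b' c'
      simp only [asm, mix_assemble, nestedVal_assemble, hst]
      simp [hij.symm, hil.symm, hjl.symm]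
    obtain ⟨ya, hya⟩ := (hE i).mono h1
    obtain ⟨xc, hxc⟩ := (hL l).anti h2
    choose xa hxa using hya
    choose yc hyc using hxc
    -- With equal values of the copies `i` and `l`, the value is the one of the copy `j`.
    have hpass : ∀ b b', nestedVal q (h + 1)
        (mix r (T j) (asm (xa 0 q.zero_le) b xc) (asm ya b' (yc 0 q.zero_le))) =
          nestedVal q h (mix (fun v => r (.sub j v)) (T j) b b') := fun b b' => by
      rw [hval, hxa, hyc, guarded, if_pos rfl]
    refine ⟨T j, ?_, ?_, ?_⟩
    · obtain ⟨y, hy⟩ := hE j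
      refine ⟨asm ya y (yc 0 q.zero_le), fun a ha => ?_⟩
      obtain ⟨x, hx⟩ := hy a ha
      exact ⟨asm (xa 0 q.zero_le) x xc, (hpass x y).trans hx⟩
    · obtain ⟨x, hx⟩ := hL j
      refine ⟨asm (xa 0 q.zero_le) x xc, fun a ha => ?_⟩
      obtain ⟨y, hy⟩ := hx a ha
      exact ⟨asm ya y (yc 0 q.zero_le), (hpass x y).trans hy⟩
    · obtain ⟨p, hp0, hp⟩ := hM j
      -- The first entry of the index is the value of copy `i`, the others index a prefix of copy `j`.
      have hzero : ∀ (f : Fin (h + 1) → Fin (q + 1)) (b : Fin (q + 1)) (y : Var q h → Bool),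
          nestedVal q (h + 1) (mix r (T j)
            (asm (xa (f 0) (Nat.lt_succ_iff.1 (f 0).2)) (p (Fin.tail f)) xc)
            (asm ya y (yc b (Nat.lt_succ_iff.1 b.2)))) = 0 ↔
          f 0 = b ∧ nestedVal q h (mix (fun v => r (.sub j v)) (T j) (p (Fin.tail f)) y) = 0 := by
        intro f b y
        rw [hval, hxa, hyc, guarded]
        split_ifs with hfb
        · simp [Fin.ext hfb]
        · simp [Fin.ext_iff, hfb]
      refine ⟨fun f => asm (xa (f 0) (Nat.lt_succ_iff.1 (f 0).2)) (p (Fin.tail f)) xc,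
        fun f => ?_, fun f g hfg => ?_⟩
      · obtain ⟨y, hy⟩ := hp0 (Fin.tail f)
        exact ⟨_, (hzero f (f 0) y).2 ⟨rfl, hy⟩⟩
      · by_cases hfg0 : f 0 = g 0
        · have htail : Fin.tail f ≠ Fin.tail g := fun ht => hfg <| by
            rw [← Fin.cons_self_tail f, ← Fin.cons_self_tail g, hfg0, ht]
          obtain ⟨y, hy⟩ := hp _ _ htail
          refine ⟨asm ya y (yc (f 0) (Nat.lt_succ_iff.1 (f 0).2)), ?_⟩
          rw [hzero, hzero]
          simpa [hfg0] using hy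
        · obtain ⟨y, hy⟩ := hp0 (Fin.tail f)
          refine ⟨asm ya y (yc (f 0) (Nat.lt_succ_iff.1 (f 0).2)), ?_⟩
          rw [hzero, hzero]
          simp [hy, Ne.symm hfg0]

/-! ### Small TDDs from bottom-up evaluation -/

/-- The function `f` has its values in the finite set `R` and is computed bottom-up along the vtree
`T`: the nodes that belong to the root of `T` are the elements of `R`, and `v` is satisfied exactly
by the assignments of value `v`. Every internal node of `T` contributes at most `W` to the size; the
bound is `W` times the number of leaves minus one, written without subtraction. -/
def Computes {X α : Type} (T : BinTree X) (f : (X → Bool) → α) (R : Finset α) (W : ℕ) : Prop :=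
  (∀ τ, f τ ∈ R) ∧ ∃ C : Diagram T R.card, C.Deterministic ∧
    C.size + W ≤ W * T.leaves.length ∧
    ∀ τ (v : R), C.Sat (R.equivFin v) τ ↔ f τ = v

theorem computes_leaf {X α : Type} (x : X) (g : Bool → α) {R : Finset α} (W : ℕ)
    (hg : ∀ b, g b ∈ R) : Computes (.leaf x) (fun τ => g (τ x)) R W := by
  classical
  let label : Fin R.card → LeafLabel := fun i =>
    if g true = R.equivFin.symm i then
      if g false = R.equivFin.symm i then .one else .pos
    else if g false = R.equivFin.symm i then .neg else .zero
  have hlabel : ∀ i b, (label i).Sat b ↔ g b = R.equivFin.symm i := by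
    intro i b
    simp only [label]
    cases b <;> split_ifs <;> simp_all [LeafLabel.Sat]
  refine ⟨fun τ => hg _, .leaf x label, ?_, ?_, fun τ v => ?_⟩
  · rintro i j hij b ⟨hi, hj⟩
    rw [hlabel] at hi hj
    exact hij (R.equivFin.symm.injective (Subtype.ext (hi.symm.trans hj)))
  · simp [Diagram.size, BinTree.leaves]
  · exact (hlabel _ _).trans (by simp)

theorem Computes.node {X α β γ : Type} {l r : BinTree X} {f₁ : (X → Bool) → α}
    {f₂ : (X → Bool) → β} {R₁ : Finset α} {R₂ : Finset β} {W : ℕ} (h₁ : Computes l f₁ R₁ W)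
    (h₂ : Computes r f₂ R₂ W) (op : α → β → γ) {R : Finset γ}
    (hop : ∀ a ∈ R₁, ∀ b ∈ R₂, op a b ∈ R) (hW : R₁.card * R₂.card ≤ W) :
    Computes (.node l r) (fun τ => op (f₁ τ) (f₂ τ)) R W := by
  classical
  obtain ⟨hR₁, C₁, hd₁, hs₁, hC₁⟩ := h₁
  obtain ⟨hR₂, C₂, hd₂, hs₂, hC₂⟩ := h₂
  let E : Fin R.card → Finset (Fin R₁.card × Fin R₂.card) := fun i =>
    Finset.univ.filter fun p =>
      op (R₁.equivFin.symm p.1) (R₂.equivFin.symm p.2) = R.equivFin.symm i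
  have hE : ∀ i j, i ≠ j → Disjoint (E i) (E j) := by
    intro i j hij
    refine Finset.disjoint_filter.2 fun p _ hi hj => hij ?_
    exact R.equivFin.symm.injective (Subtype.ext (hi.symm.trans hj))
  refine ⟨fun τ => hop _ (hR₁ τ) _ (hR₂ τ), .node C₁ C₂ E, ⟨hd₁, hd₂, hE⟩, ?_, fun τ v => ?_⟩
  · have hcard : ∑ g, (E g).card ≤ R₁.card * R₂.card := by
      rw [← Finset.card_biUnion fun i _ j _ hij => hE i j hij]
      exact (Finset.card_le_univ _).trans (by simp)
    simp only [Diagram.size, BinTree.leaves, List.length_append, mul_add]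
    omega
  · constructor
    · rintro ⟨p, hp, h1, h2⟩
      have hp := (Finset.mem_filter.1 hp).2
      have h1 := (hC₁ τ (R₁.equivFin.symm p.1)).1 (by simpa using h1)
      have h2 := (hC₂ τ (R₂.equivFin.symm p.2)).1 (by simpa using h2)
      rw [← h1, ← h2] at hp
      simpa using hp
    · intro h
      refine ⟨(R₁.equivFin ⟨_, hR₁ τ⟩, R₂.equivFin ⟨_, hR₂ τ⟩), ?_, (hC₁ τ _).2 rfl, (hC₂ τ _).2 rfl⟩
      exact Finset.mem_filter.2 ⟨Finset.mem_univ _, by simpa using h⟩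

/-- A function computed along a vtree yields, for every value `v`, a TDD for `f τ = v`. -/
theorem Computes.exists_tdd {X α : Type} {T : BinTree X} {f : (X → Bool) → α} {R : Finset α} {W : ℕ}
    (h : Computes T f R W) (hT : T.IsVTree) {v : α} (hv : v ∈ R) {F : CNF X}
    (hF : ∀ τ, F.Sat τ ↔ f τ = v) :
    ∃ C : TDD X, C.Represents F ∧ C.size ≤ W * T.leaves.length := by
  obtain ⟨-, C, hd, hs, hC⟩ := h
  refine ⟨⟨T, hT, R.card, C, hd, R.equivFin ⟨v, hv⟩⟩, fun τ => ?_, ?_⟩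
  · rw [hF]
    exact hC τ ⟨v, hv⟩
  · exact le_of_add_le_left hs

/-! ### A vtree for the nested comparison function -/

/-- The right comb with leaves `ι 0, …, ι m`. -/
def comb {X : Type} : (m : ℕ) → (Fin (m + 1) → X) → BinTree X
  | 0, ι => .leaf (ι 0)
  | m + 1, ι => .node (.leaf (ι 0)) (comb m fun i => ι i.succ)

theorem leaves_comb {X : Type} (m : ℕ) (ι : Fin (m + 1) → X) :
    (comb m ι).leaves = List.ofFn ι := by
  induction m with
  | zero => simp [comb, BinTree.leaves]
  | succ m ih =>
    rw [List.ofFn_succ, comb, BinTree.leaves, ih]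
    rfl

theorem computes_comb {X : Type} {B W : ℕ} (hW : 2 * B ≤ W) (m : ℕ) (ι : Fin (m + 1) → X)
    (hm : m + 1 < B) :
    Computes (comb m ι) (fun τ => ∑ i, (τ (ι i)).toNat) (Finset.range (m + 2)) W := by
  induction m with
  | zero =>
    simpa [comb] using computes_leaf (ι 0) Bool.toNat (R := Finset.range 2) W (by decide)
  | succ m ih =>
    simp only [Fin.sum_univ_succ (n := m + 1)]
    refine Computes.node (computes_leaf (ι 0) Bool.toNat (R := Finset.range 2) W (by decide))
      (ih (fun i => ι i.succ) (by omega)) (fun a b => a + b) ?_ ?_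
    · intro a ha b hb
      simp only [Finset.mem_range] at *
      omega
    · simp only [Finset.card_range]
      omega

/-- The vtree that evaluates `nestedVal q h` where the variable `v` is read from `ι v`. -/
def nestedTree {X : Type} (q : ℕ) : (h : ℕ) → (Var q h → X) → BinTree X
  | 0, ι => comb (2 * q) fun i => ι (.block i)
  | h + 1, ι =>
    .node (.node (.leaf (ι (.sel false))) (.leaf (ι (.sel true))))
      (.node (.node (nestedTree q h fun v => ι (.sub 0 v)) (nestedTree q h fun v => ι (.sub 1 v)))
        (nestedTree q h fun v => ι (.sub 2 v)))

theorem mem_leaves_nestedTree {X : Type} (q h : ℕ) (ι : Var q h → X) (x : X) :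
    x ∈ (nestedTree q h ι).leaves ↔ ∃ v, ι v = x := by
  induction h with
  | zero =>
    rw [nestedTree, leaves_comb, List.mem_ofFn]
    rfl
  | succ h ih =>
    simp only [nestedTree, BinTree.leaves, List.mem_append, List.mem_singleton, ih]
    constructor
    · rintro ((rfl | rfl) | (⟨v, rfl⟩ | ⟨v, rfl⟩) | ⟨v, rfl⟩) <;> exact ⟨_, rfl⟩
    · rintro ⟨v, rfl⟩
      match v with
      | .inl false => exact .inl (.inl rfl)
      | .inl true => exact .inl (.inr rfl)
      | .inr (0, v) => exact .inr (.inl (.inl ⟨v, rfl⟩))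
      | .inr (1, v) => exact .inr (.inl (.inr ⟨v, rfl⟩))
      | .inr (2, v) => exact .inr (.inr ⟨v, rfl⟩)

theorem Var.sel_ne_sub {q h : ℕ} (b : Bool) (i : Fin 3) (v : Var q h) : Var.sel b ≠ Var.sub i v :=
  Sum.inl_ne_inr

theorem Var.sub_ne_sub {q h : ℕ} {i j : Fin 3} (hij : i ≠ j) (v w : Var q h) :
    Var.sub i v ≠ Var.sub j w := fun hvw => hij (congrArg Prod.fst (Sum.inr_injective hvw))

theorem nodup_leaves_nestedTree {X : Type} (q h : ℕ) {ι : Var q h → X} (hι : Function.Injective ι) :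
    (nestedTree q h ι).leaves.Nodup := by
  induction h with
  | zero =>
    rw [nestedTree, leaves_comb, List.nodup_ofFn]
    exact hι
  | succ h ih =>
    have hsub : ∀ i, (nestedTree q h fun v => ι (.sub i v)).leaves.Nodup := fun i =>
      ih (hι.comp (Var.sub_injective i))
    have hdisj : ∀ i j : Fin 3, i ≠ j → ∀ v w, ι (.sub i v) ≠ ι (.sub j w) := fun i j hij v w =>
      hι.ne (Var.sub_ne_sub hij v w)
    simp only [nestedTree, BinTree.leaves, List.nodup_append', List.disjoint_left, List.mem_append,
      List.mem_singleton, mem_leaves_nestedTree]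
    refine ⟨⟨by simp, by simp, ?_⟩, ⟨⟨hsub 0, hsub 1, ?_⟩, hsub 2, ?_⟩, ?_⟩
    · rintro _ rfl hx
      exact absurd (Var.sel_injective (hι hx)) (by decide)
    · rintro _ ⟨v, rfl⟩ ⟨w, hw⟩
      exact hdisj 1 0 (by decide) _ _ hw
    · rintro _ (⟨v, rfl⟩ | ⟨v, rfl⟩) ⟨w, hw⟩
      · exact hdisj 2 0 (by decide) _ _ hw
      · exact hdisj 2 1 (by decide) _ _ hw
    · rintro _ (rfl | rfl) ((⟨w, hw⟩ | ⟨w, hw⟩) | ⟨w, hw⟩) <;>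
        exact Var.sel_ne_sub _ _ _ (hι hw).symm

theorem computes_nestedTree {X : Type} (q h : ℕ) (ι : Var q h → X) :
    Computes (nestedTree q h ι) (fun τ => nestedVal q h fun v => τ (ι v))
      (Finset.range (2 * q + 2)) (4 * (2 * q + 2) ^ 3) := by
  set B := 2 * q + 2 with hB
  have hB2 : 2 ≤ B := by omega
  have h23 : B ^ 2 ≤ B ^ 3 := Nat.pow_le_pow_right (by omega) (by omega)
  have h12 : B ≤ B ^ 2 := Nat.le_self_pow (by omega) B
  induction h with
  | zero => exact computes_comb (B := B) (by omega) (2 * q) (fun i => ι (.block i)) (by omega)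
  | succ h ih =>
    have hsel : ∀ b, Computes (.leaf (ι (.sel b))) (fun τ => τ (ι (.sel b))) Finset.univ
        (4 * B ^ 3) := fun b => computes_leaf _ id _ fun _ => Finset.mem_univ _
    have h01 := (ih fun v => ι (.sub 0 v)).node (ih fun v => ι (.sub 1 v)) Prod.mk
      (R := Finset.range B ×ˢ Finset.range B)
      (fun a ha b hb => Finset.mem_product.2 ⟨ha, hb⟩) (by simp only [Finset.card_range]; nlinarith)
    have h012 := h01.node (ih fun v => ι (.sub 2 v)) Prod.mk
      (R := (Finset.range B ×ˢ Finset.range B) ×ˢ Finset.range B)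
      (fun a ha b hb => Finset.mem_product.2 ⟨ha, hb⟩)
      (by simp only [Finset.card_range, Finset.card_product]; nlinarith)
    have hst := (hsel false).node (hsel true) Prod.mk (R := Finset.univ)
      (fun a ha b hb => Finset.mem_univ _) (by simp; omega)
    have hfin := hst.node h012 (fun s v => combine s.1 s.2 ![v.1.1, v.1.2, v.2])
      (R := Finset.range B) ?_ ?_
    · rw [nestedTree]
      convert hfin using 1
      funext τ
      exact congrArg (combine _ _) (funext fun i => by fin_cases i <;> rfl)
    · intro s _ v hv
      simp only [Finset.mem_product, Finset.mem_range] at hv ⊢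
      refine Nat.lt_of_le_pred (by omega) (combine_le (m := B - 1) (by omega) fun i => ?_)
      obtain ⟨⟨h0, h1⟩, h2⟩ := hv
      fin_cases i <;> simp <;> omega
    · simp only [Finset.card_product, Finset.card_range, Finset.card_univ, Fintype.card_prod,
        Fintype.card_bool]
      nlinarith

/-! ### Padding with variables that are forced to be true -/

/-- The vtree `T` with the leaves of the list `L` added at the top. -/
def padTree {X : Type} (T : BinTree X) : List X → BinTree X
  | [] => T
  | x :: L => .node (.leaf x) (padTree T L)

theorem leaves_padTree {X : Type} (T : BinTree X) (L : List X) :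
    (padTree T L).leaves = L ++ T.leaves := by
  induction L with
  | nil => rfl
  | cons x L ih => simp [padTree, BinTree.leaves, ih]

theorem Computes.padTree {X : Type} {T : BinTree X} {f : (X → Bool) → ℕ} {B W : ℕ}
    (h : Computes T f (Finset.range B) W) (hB : 2 ≤ B) (hW : 2 * B ≤ W) (L : List X) :
    Computes (padTree T L) (fun τ => if ∀ x ∈ L, τ x = true then f τ else 1) (Finset.range B) W := by
  induction L with
  | nil => simpa [KComp.padTree] using h
  | cons x L ih =>
    have := (computes_leaf x id (R := Finset.univ) W fun _ => Finset.mem_univ _).node ih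
      (fun b a => if b = true then a else 1) (R := Finset.range B)
      (fun b _ a ha => by
        simp only [Finset.mem_range] at *
        split_ifs <;> omega) (by simpa using hW)
    rw [KComp.padTree]
    convert this using 1
    funext τ
    by_cases hx : τ x = true <;> simp [hx]

/-! ### The family of formulas -/

section Family

variable {X : Type} {q h : ℕ}

theorem exists_nestedVal_eq (q h : ℕ) : (∃ x, nestedVal q h x = 0) ∧ ∃ x, nestedVal q h x ≠ 0 := by
  induction h with
  | zero =>
    refine ⟨⟨fun _ => false, Finset.sum_eq_zero fun _ _ => rfl⟩, fun _ => true, ?_⟩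
    have : nestedVal q 0 (fun _ => true) = ∑ _i : Fin (2 * q + 1), 1 := rfl
    simp [this]
  | succ h ih =>
    obtain ⟨⟨x, hx⟩, y, hy⟩ := ih
    refine ⟨⟨assemble false false fun _ => x, ?_⟩, assemble false false fun _ => y, ?_⟩
    · simp [nestedVal_assemble, combine, guarded, hx]
    · simp [nestedVal_assemble, combine, guarded, hy]

/-- The assignment that is `x` on the range of `ι` and true elsewhere. -/
noncomputable def padAssignment (ι : Var q h → X) (x : Var q h → Bool) : X → Bool :=
  Function.extend ι x fun _ => true

theorem mix_padAssignment {ι : Var q h → X} (hι : Function.Injective ι) (r : X → ℕ) (t : ℕ)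
    (x y : Var q h → Bool) :
    mix r t (padAssignment ι x) (padAssignment ι y) =
      padAssignment ι (mix (fun v => r (ι v)) t x y) := by
  funext z
  by_cases hz : ∃ v, ι v = z
  · obtain ⟨v, rfl⟩ := hz
    simp [mix, padAssignment, hι.extend_apply]
  · simp [mix, padAssignment, Function.extend_apply' _ _ _ hz]

variable [Fintype X]

open Classical in
/-- The variables that are not read by `nestedVal q h`. -/
noncomputable def padding (ι : Var q h → X) : List X :=
  (Finset.univ.filter fun x => x ∉ Set.range ι).toList

theorem mem_padding {ι : Var q h → X} {x : X} : x ∈ padding ι ↔ x ∉ Set.range ι := by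
  simp [padding]

/-- The value of `nestedVal q h` on the variables in the range of `ι` if all other variables are
true, and `1` otherwise. -/
noncomputable def paddedVal (ι : Var q h → X) (τ : X → Bool) : ℕ :=
  if ∀ x ∈ padding ι, τ x = true then nestedVal q h fun v => τ (ι v) else 1

/-- The CNF formula whose models are the zeros of `paddedVal ι`. -/
noncomputable def zeroCNF (ι : Var q h → X) : CNF X :=
  fullCNF fun τ => paddedVal ι τ = 0

theorem zeroCNF_sat (ι : Var q h → X) (τ : X → Bool) : (zeroCNF ι).Sat τ ↔ paddedVal ι τ = 0 :=
  fullCNF_sat _ _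

theorem paddedVal_padAssignment {ι : Var q h → X} (hι : Function.Injective ι) (x : Var q h → Bool) :
    paddedVal ι (padAssignment ι x) = nestedVal q h x := by
  have hpad : ∀ y ∈ padding ι, padAssignment ι x y = true := fun y hy =>
    Function.extend_apply' _ _ _ (mem_padding.1 hy)
  rw [paddedVal, if_pos hpad]
  exact congrArg _ (funext fun v => hι.extend_apply _ _ v)

theorem zeroCNF_vars {ι : Var q h → X} (hι : Function.Injective ι) :
    (zeroCNF ι).vars = Set.univ := by
  obtain ⟨-, x, hx⟩ := exists_nestedVal_eq q h
  exact fullCNF_vars ⟨padAssignment ι x, by rwa [paddedVal_padAssignment hι]⟩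

theorem exists_tdd_zeroCNF {ι : Var q h → X} (hι : Function.Injective ι) :
    ∃ C : TDD X, C.Represents (zeroCNF ι) ∧
      C.size ≤ 4 * (2 * q + 2) ^ 3 * Fintype.card X := by
  classical
  have hcomp := (computes_nestedTree q h ι).padTree (by omega)
    (by nlinarith [Nat.le_self_pow (n := 3) (by omega) (2 * q + 2)]) (padding ι)
  have hmem : ∀ x, x ∈ (padTree (nestedTree q h ι) (padding ι)).leaves := fun x => by
    rw [leaves_padTree, List.mem_append, mem_padding, mem_leaves_nestedTree]
    exact (em _).symm
  have hnodup : (padTree (nestedTree q h ι) (padding ι)).leaves.Nodup := by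
    rw [leaves_padTree, List.nodup_append']
    refine ⟨Finset.nodup_toList _, nodup_leaves_nestedTree q h hι, fun x hx hx' => ?_⟩
    exact mem_padding.1 hx ((mem_leaves_nestedTree q h ι x).1 hx')
  obtain ⟨C, hC, hs⟩ := hcomp.exists_tdd ⟨hnodup, hmem⟩ (v := 0) (by simp) (zeroCNF_sat ι)
  exact ⟨C, hC, hs.trans (Nat.mul_le_mul_left _ hnodup.length_le_card)⟩

theorem pow_le_size_of_represents_zeroCNF {ι : Var q h → X} (hι : Function.Injective ι) {D : OBDD X}
    (hD : D.Represents (zeroCNF ι)) : (q + 1) ^ h ≤ D.size := by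
  obtain ⟨r, hr, hsize⟩ := OBDD.exists_rank_card_le_size hD
  obtain ⟨t, -, -, p, -, hp⟩ := exists_cut (r := fun v => r (ι v)) (hr.comp hι)
  have := hsize t _ (fun i => padAssignment ι (p i)) fun i j hij => by
    obtain ⟨y, hy⟩ := hp i j hij
    refine ⟨padAssignment ι y, ?_⟩
    rwa [zeroCNF_sat, zeroCNF_sat, mix_padAssignment hι, mix_padAssignment hι,
      paddedVal_padAssignment hι, paddedVal_padAssignment hι]
  simpa using this

theorem two_le_size_of_represents_zeroCNF {ι : Var q h → X} (hι : Function.Injective ι) {D : OBDD X}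
    (hD : D.Represents (zeroCNF ι)) : 2 ≤ D.size := by
  obtain ⟨⟨x, hx⟩, y, hy⟩ := exists_nestedVal_eq q h
  obtain ⟨r, -, hsize⟩ := OBDD.exists_rank_card_le_size hD
  -- Beyond all ranks, the prefixes are full assignments.
  have hfull : ∀ z z' : X → Bool, mix r (Finset.univ.sup r + 1) z z' = z := fun z z' =>
    funext fun v => if_pos (Nat.lt_succ_of_le (Finset.le_sup (Finset.mem_univ v)))
  have := hsize _ Bool (fun b => padAssignment ι (if b = true then x else y)) fun b c hbc => by
    refine ⟨fun _ => true, ?_⟩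
    rw [hfull, hfull, zeroCNF_sat, zeroCNF_sat, paddedVal_padAssignment hι,
      paddedVal_padAssignment hι]
    cases b <;> cases c <;> simp_all
  simpa using this

end Family

/-- The witness is `zeroCNF` for blocks of `2 * q + 1` variables with `q = 2 ^ k - 1`, nested to depth
`k`. -/
theorem exists_cnf_fin {n k : ℕ} (hk : 2 ^ (4 * k) ≤ n) :
    ∃ F : CNF (Fin n), F.vars = Set.univ ∧
      (∃ C : TDD (Fin n), C.Represents F ∧ C.size ≤ 32 * n ^ 2) ∧
      ∀ D : OBDD (Fin n), D.Represents F → 2 ≤ D.size ∧ 2 ^ (k * k) ≤ D.size := by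
  have hq : 2 ^ k - 1 + 1 = 2 ^ k := Nat.sub_add_cancel Nat.one_le_two_pow
  have hB : 2 * (2 ^ k - 1) + 2 = 2 * 2 ^ k := by omega
  have h16 : (2 : ℕ) ^ (4 * k) = 16 ^ k := by rw [pow_mul]; norm_num
  have hcard : Fintype.card (Var (2 ^ k - 1) k) ≤ Fintype.card (Fin n) := by
    have hc := Var.card_add_one (2 ^ k - 1) k
    rw [hB] at hc
    have h6 : 3 ^ k * (2 * 2 ^ k) = 2 * 6 ^ k := by
      rw [show (6 : ℕ) = 3 * 2 from rfl, mul_pow]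
      ring
    have h616 : (6 : ℕ) ^ k ≤ 16 ^ k := Nat.pow_le_pow_left (by omega) k
    rw [Fintype.card_fin]
    -- `2 * 6 ^ k ≤ 16 ^ k` fails for `k = 0`, where one block of a single variable is left.
    rcases Nat.eq_zero_or_pos k with rfl | hpos
    · rw [h6, pow_zero 6] at hc
      rw [h16, pow_zero] at hk
      omega
    · obtain ⟨m, rfl⟩ := Nat.exists_eq_succ_of_ne_zero hpos.ne'
      have : (6 : ℕ) ^ m ≤ 16 ^ m := Nat.pow_le_pow_left (by omega) m
      simp only [Nat.succ_eq_add_one, pow_succ] at *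
      omega
  obtain ⟨ι⟩ := Function.Embedding.nonempty_of_card_le hcard
  refine ⟨zeroCNF ι, zeroCNF_vars ι.injective, ?_, fun D hD =>
    ⟨two_le_size_of_represents_zeroCNF ι.injective hD, ?_⟩⟩
  · obtain ⟨C, hC, hs⟩ := exists_tdd_zeroCNF ι.injective
    refine ⟨C, hC, hs.trans ?_⟩
    rw [hB, Fintype.card_fin]
    have h8 : 4 * (2 * 2 ^ k) ^ 3 = 32 * 8 ^ k := by
      rw [mul_pow, ← pow_mul, mul_comm k 3, pow_mul]
      ring
    have h816 : (8 : ℕ) ^ k ≤ n := (Nat.pow_le_pow_left (by omega) k).trans (h16 ▸ hk)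
    rw [h8]
    nlinarith
  · have := pow_le_size_of_represents_zeroCNF ι.injective hD
    rwa [hq, ← pow_mul] at this

/-- The bound `2 ^ (k * k)` is `n ^ (Ω(log n))`; it is trivial for `n < 16`, where the lower
bound `2` takes over. -/
theorem rpow_logb_le {n s : ℕ} (hn : 1 ≤ n) (h2 : 2 ≤ s)
    (hs : 2 ^ (Nat.log 2 n / 4 * (Nat.log 2 n / 4)) ≤ s) :
    (n : ℝ) ^ ((1 / 64 : ℝ) * Real.logb 2 n) ≤ s := by
  set k := Nat.log 2 n / 4
  set L := Real.logb 2 n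
  have hn0 : (0 : ℝ) < n := by exact_mod_cast hn
  have hL0 : 0 ≤ L := Real.logb_nonneg (by norm_num) (by exact_mod_cast hn)
  have hL : L ≤ 4 * (k + 1) := by
    have hlt : n < 2 ^ (4 * (k + 1)) := (Nat.lt_pow_succ_log_self (by norm_num) n).trans_le
      (Nat.pow_le_pow_right (by norm_num) (by omega))
    have hlt' : (n : ℝ) ≤ 2 ^ (4 * ((k : ℝ) + 1)) := by
      have : (n : ℝ) ≤ ((2 ^ (4 * (k + 1)) : ℕ) : ℝ) := by exact_mod_cast hlt.le
      refine this.trans_eq ?_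
      rw [Nat.cast_pow, ← Real.rpow_natCast]
      push_cast
      rfl
    rwa [← Real.logb_le_iff_le_rpow (by norm_num) hn0] at hlt'
  have hpow : (n : ℝ) ^ ((1 / 64 : ℝ) * L) = 2 ^ (L ^ 2 / 64) := by
    conv_lhs => rw [← Real.rpow_logb (b := 2) (by norm_num) (by norm_num) hn0]
    rw [← Real.rpow_mul (by norm_num)]
    congr 1
    ring
  rw [hpow]
  rcases Nat.eq_zero_or_pos k with hk | hk
  · have h2' : (2 : ℝ) ≤ s := by exact_mod_cast h2
    refine le_trans ?_ h2'
    rw [hk] at hL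
    norm_num at hL
    calc (2 : ℝ) ^ (L ^ 2 / 64) ≤ 2 ^ (1 : ℝ) :=
          Real.rpow_le_rpow_of_exponent_le (by norm_num) (by nlinarith)
      _ = 2 := Real.rpow_one 2
  · have hk' : (1 : ℝ) ≤ k := by exact_mod_cast hk
    calc (2 : ℝ) ^ (L ^ 2 / 64) ≤ 2 ^ ((k * k : ℕ) : ℝ) := by
          refine Real.rpow_le_rpow_of_exponent_le (by norm_num) ?_
          push_cast
          have : L ≤ 8 * k := by linarith
          nlinarith
      _ = ((2 ^ (k * k) : ℕ) : ℝ) := by rw [Real.rpow_natCast]; push_cast; rfl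
      _ ≤ s := by exact_mod_cast hs

end KComp

theorem mainTheorem9 :
    ∃ (F : (n : ℕ) → CNF (Fin n)) (p : Polynomial ℕ) (c : ℝ), 0 < c ∧
      ∀ n : ℕ, 1 ≤ n →
        CNF.vars (F n) = Set.univ ∧
        (∃ C : TDD (Fin n), C.Represents (F n) ∧ C.size ≤ p.eval n) ∧
        ∀ D : OBDD (Fin n), D.Represents (F n) →
          (n : ℝ) ^ (c * Real.logb 2 (n : ℝ)) ≤ (D.size : ℝ) := by
  have hF : ∀ n : ℕ, ∃ F : CNF (Fin n), 1 ≤ n → F.vars = Set.univ ∧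
      (∃ C : TDD (Fin n), C.Represents F ∧ C.size ≤ 32 * n ^ 2) ∧
      ∀ D : OBDD (Fin n), D.Represents F →
        2 ≤ D.size ∧ 2 ^ (Nat.log 2 n / 4 * (Nat.log 2 n / 4)) ≤ D.size := fun n => by
    rcases Nat.eq_zero_or_pos n with rfl | hn
    · exact ⟨∅, fun h => absurd h (by norm_num)⟩
    · have hk : 2 ^ (4 * (Nat.log 2 n / 4)) ≤ n :=
        (Nat.pow_le_pow_right (by norm_num) (Nat.mul_div_le _ _)).trans
          (Nat.pow_log_le_self 2 (by omega))
      obtain ⟨F, hF⟩ := exists_cnf_fin hk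
      exact ⟨F, fun _ => hF⟩
  choose F hF using hF
  refine ⟨F, 32 * Polynomial.X ^ 2, 1 / 64, by norm_num, fun n hn => ?_⟩
  obtain ⟨hvars, ⟨C, hC, hs⟩, hD⟩ := hF n hn
  refine ⟨hvars, ⟨C, hC, by simpa using hs⟩, fun D hDF => ?_⟩
  exact rpow_logb_le hn (hD D hDF).1 (hD D hDF).2
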